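/- Let $d$ be a natural number and $\mathbb{T}^d=\mathbb{R}^d/\mathbb{Z}^d$ with its Haar probability measure. For $f\in\ell^2(\mathbb{Z}^d)$ (complex-valued) let $\mathcal{F}f(\xi)=\sum_{n\in\mathbb{Z}^d}f(n)e^{2\pi i n\cdot\xi}\in L^2(\mathbb{T}^d)$ be its Fourier transform (the series converging in $L^2(\mathbb{T}^d)$). For $r>1$, $L^{r,\infty}(\mathbb{T}^d)$ denotes the space of measurable functions $m:\mathbb{T}^d\to\mathbb{C}$ for which there is a constant $c>0$ with $|\{\xi\in\mathbb{T}^d:|m(\xi)|\ge s\}|\le c\,s^{-r}$ for all $s>0$. The Fourier multiplier transformation $T_m$ is defined by $\mathcal{F}(T_mf)=m\,\mathcal{F}f$, that is, $T_mf(n)=\int_{\mathbb{T}^d}m(\xi)\,\mathcal{F}f(\xi)\,e^{-2\pi i n\cdot\xi}\,d\xi$ for $n\in\mathbb{Z}^d$, whenever $m\,\mathcal{F}f$ is integrable. Let $\alpha>1$, let $m\in L^{\alpha,\infty}(\mathbb{T}^d)$, and let $1<p\le 2\le q<\infty$ satisfy $\frac1p-\frac1q=\frac1\alpha$. Then $m\,\mathcal{F}f$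 is integrable for every $f\in\ell^p(\mathbb{Z}^d)\subset\ell^2(\mathbb{Z}^d)$, and $T_m$ is a bounded linear operator from $\ell^p(\mathbb{Z}^d)$ to $\ell^q(\mathbb{Z}^d)$: there is a constant $C$ such that $\|T_mf\|_{\ell^q}\le C\|f\|_{\ell^p}$ for all $f\in\ell^p(\mathbb{Z}^d)$. -/

import Mathlib

open MeasureTheory
open scoped ENNReal

noncomputable section

/-- The sequence space `ℓ^p(ℤ^d)` of complex-valued functions on `ℤ^d`. -/
abbrev ellZ (d : ℕ) (p : ℝ≥0∞) : AddSubgroup (PreLp fun _ : Fin d → ℤ => ℂ) :=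
  lp (fun _ : Fin d → ℤ => ℂ) p

/-- The Haar probability measure on the torus `𝕋^d = ℝ^d/ℤ^d`. -/
abbrev torusMeasure (d : ℕ) : Measure (UnitAddTorus (Fin d)) :=
  Measure.pi fun _ : Fin d => (AddCircle.haarAddCircle : Measure UnitAddCircle)

/-- The weak Lebesgue space `L^{r,∞}(𝕋^d)`: measurable functions `m` on the torus `ℝ^d/ℤ^d` such
that, for some `c > 0`, the set `{|m| ≥ s}` has measure at most `c / s^r` for every `s > 0`. -/
def MemWeakL {d : ℕ} (m : UnitAddTorus (Fin d) → ℂ) (r : ℝ) : Prop :=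
  AEStronglyMeasurable m (torusMeasure d) ∧
    ∃ c : ℝ, 0 < c ∧ ∀ s : ℝ, 0 < s →
      torusMeasure d {ξ : UnitAddTorus (Fin d) | s ≤ ‖m ξ‖} ≤ ENNReal.ofReal (c / s ^ r)

/-- The Fourier transform `ℓ²(ℤ^d) → L²(𝕋^d)`, `f ↦ ∑ₙ f(n) e^{2πi n·ξ}` (convergence in `L²`). -/
def fourierZ {d : ℕ} (f : ellZ d 2) :
    Lp ℂ 2 (torusMeasure d) :=
  UnitAddTorus.mFourierBasis.repr.symm f

theorem hasSum_fourierZ {d : ℕ} (f : ellZ d 2) :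
    HasSum (fun n : Fin d → ℤ => f n • UnitAddTorus.mFourierLp 2 n) (fourierZ f) := by
  have h := (UnitAddTorus.mFourierBasis (d := Fin d)).hasSum_repr_symm f
  rwa [UnitAddTorus.coe_mFourierBasis] at h

/-- The inclusion `ℓ^p(ℤ^d) ⊆ ℓ²(ℤ^d)` for `p ≤ 2`. -/
def toEll2 {d : ℕ} {p : ℝ≥0∞} (hp : p ≤ 2) (f : ellZ d p) : ellZ d 2 :=
  AddSubgroup.inclusion (lp.monotone hp) f

/-- The function `m · 𝓕(f)` on the torus. -/
def symbolMul {d : ℕ} (m : UnitAddTorus (Fin d) → ℂ) (f : ellZ d 2) :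
    UnitAddTorus (Fin d) → ℂ :=
  fun ξ => m ξ * fourierZ f ξ

/-- The multiplier transformation `T_m f = 𝓕⁻¹(m · 𝓕(f))`, that is
`T_m f (n) = ∫ m(ξ) 𝓕(f)(ξ) e^{-2πi n·ξ} dξ` (meaningful when `m · 𝓕(f)` is integrable). -/
def multiplierT {d : ℕ} (m : UnitAddTorus (Fin d) → ℂ) (f : ellZ d 2) : (Fin d → ℤ) → ℂ :=
  UnitAddTorus.mFourierCoeff (symbolMul m f)

end

/-! The core is a weighted inequality: for 1 < p < 2 and u ≥ 0 in weak L^{p/(2-p)}, ∫ u |𝓕f|² is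
bounded on the unit ball of ℓ^p (`lintegral_weight_mul_fourierZ_sq_le`). By the layer-cake formula
the integral is ∫₀^∞ ∫_{u ≥ s} |𝓕f|² ds. At level s, split f at height s^{-1/(2-p)}: the large
coefficients are controlled by the sup bound ‖𝓕g‖_∞ ≤ ‖g‖₁ and the measure of {u ≥ s}, the small
ones by Parseval. The resulting bound is a sum over coefficients, and integrating each term in s
gives a multiple of |f(n)|^p.

Let r be the exponent conjugate to q, so that 1/p + 1/r = 1 + 1/α. Then |m| = |m|^θ |m|^η with θ =
α(1/p - 1/2), η = α(1/r - 1/2), θ + η = 1. The weights |m|^{2θ} and |m|^{2η} suit the exponents p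
and r, so Cauchy–Schwarz bounds ∫ |m| |𝓕f| |𝓕g| on unit balls of ℓ^p and ℓ^r. Taking 𝓕g = 1 gives
integrability of m 𝓕f; ℓ^q–ℓ^r duality on finite sets gives the norm bound. -/

theorem fourierZ_add {d : ℕ} (f g : ellZ d 2) : fourierZ (f + g) = fourierZ f + fourierZ g :=
  map_add _ f g

theorem fourierZ_smul {d : ℕ} (c : ℂ) (f : ellZ d 2) : fourierZ (c • f) = c • fourierZ f :=
  map_smul _ c f

/-- Parseval's identity for the Fourier transform on `ℓ²(ℤ^d)`. -/
theorem lintegral_enorm_fourierZ_sq {d : ℕ} (f : ellZ d 2) :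
    ∫⁻ ξ, ‖fourierZ f ξ‖ₑ ^ 2 ∂torusMeasure d = ∑' n, ‖f n‖ₑ ^ 2 := by
  have h1 : ‖fourierZ f‖ = ‖f‖ := (UnitAddTorus.mFourierBasis (d := Fin d)).repr.symm.norm_map f
  have h2 : ∫⁻ ξ, ‖fourierZ f ξ‖ₑ ^ 2 ∂torusMeasure d = ‖fourierZ f‖ₑ ^ 2 := by
    rw [Lp.enorm_def, eLpNorm_eq_lintegral_rpow_enorm_toReal (by simp) (by simp)]
    rw [← ENNReal.rpow_natCast, ← ENNReal.rpow_mul]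
    simp
  have h3 := lp.hasSum_norm (p := 2) (by simp) f
  rw [h2, ← ofReal_norm, h1, ← ENNReal.ofReal_pow (norm_nonneg _)]
  simp only [ENNReal.toReal_ofNat, Real.rpow_ofNat] at h3
  rw [← h3.tsum_eq, ENNReal.ofReal_tsum_of_nonneg (fun n => by positivity) h3.summable]
  simp [ENNReal.ofReal_pow]

/-- The Fourier transform of a summable sequence is bounded by its `ℓ¹` norm. -/
theorem ae_enorm_fourierZ_le_tsum {d : ℕ} (f : ellZ d 2) :
    ∀ᵐ ξ ∂torusMeasure d, ‖fourierZ f ξ‖ₑ ≤ ∑' n, ‖f n‖ₑ := by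
  by_cases htop : ∑' n, ‖f n‖ₑ = ∞
  · simp [htop]
  have hsum : Summable fun n => ‖f n‖ := by
    have := ENNReal.summable_toReal htop
    simpa using this
  have hs : Summable fun n : Fin d → ℤ => f n • UnitAddTorus.mFourier n :=
    .of_norm (by simpa only [norm_smul, UnitAddTorus.mFourier_norm, mul_one] using hsum)
  have hL := (ContinuousMap.toLp (E := ℂ) 2 (torusMeasure d) ℂ).hasSum hs.hasSum
  have heq : fourierZ f = ContinuousMap.toLp (E := ℂ) 2 (torusMeasure d) ℂ
      (∑' n : Fin d → ℤ, f n • UnitAddTorus.mFourier n) := by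
    refine (hasSum_fourierZ f).unique ?_
    simpa only [map_smul] using! hL
  rw [heq]
  filter_upwards [ContinuousMap.coeFn_toLp (p := 2) (𝕜 := ℂ) (torusMeasure d)
    (∑' n : Fin d → ℤ, f n • UnitAddTorus.mFourier n)] with ξ hξ
  rw [hξ]
  have hn : ‖(∑' n : Fin d → ℤ, f n • UnitAddTorus.mFourier n) ξ‖ ≤ ∑' n, ‖f n‖ := by
    refine (ContinuousMap.norm_coe_le_norm _ ξ).trans ?_
    refine tsum_of_norm_bounded hsum.hasSum fun n => ?_
    rw [norm_smul, UnitAddTorus.mFourier_norm, mul_one]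
  rw [← ofReal_norm]
  refine (ENNReal.ofReal_le_ofReal hn).trans ?_
  rw [ENNReal.ofReal_tsum_of_nonneg (fun n => norm_nonneg _) hsum]
  simp

theorem coeFn_fourierZ_of_support_subset {d : ℕ} (f : ellZ d 2) (s : Finset (Fin d → ℤ))
    (hs : ∀ n ∉ s, f n = 0) :
    fourierZ f =ᵐ[torusMeasure d] fun ξ => ∑ n ∈ s, f n * UnitAddTorus.mFourier n ξ := by
  have heq : fourierZ f = ContinuousMap.toLp (E := ℂ) 2 (torusMeasure d) ℂ
      (∑ n ∈ s, f n • UnitAddTorus.mFourier n) := by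
    refine (hasSum_fourierZ f).unique ?_
    simp only [map_sum, map_smul]
    exact hasSum_sum_of_ne_finset_zero fun n hn => by rw [hs n hn, zero_smul]
  rw [heq]
  filter_upwards [ContinuousMap.coeFn_toLp (p := 2) (𝕜 := ℂ) (torusMeasure d)
    (∑ n ∈ s, f n • UnitAddTorus.mFourier n)] with ξ hξ
  rw [hξ]
  simp

/-! ### Splitting a sequence between ℓ¹ and ℓ² -/

/-- The restriction of an element of `ℓ²(ℤ^d)` to a set of indices, extended by zero. -/
noncomputable def ellRestrict {d : ℕ} (s : Set (Fin d → ℤ)) (f : ellZ d 2) : ellZ d 2 :=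
  ⟨s.indicator f, (lp.memℓp f).mono' fun n => by
    by_cases hn : n ∈ s <;> simp [hn]⟩

theorem ellRestrict_apply {d : ℕ} (s : Set (Fin d → ℤ)) (f : ellZ d 2) (n : Fin d → ℤ) :
    ellRestrict s f n = s.indicator f n := rfl

theorem ellRestrict_add_compl {d : ℕ} (s : Set (Fin d → ℤ)) (f : ellZ d 2) :
    ellRestrict s f + ellRestrict sᶜ f = f := by
  refine lp.ext ?_
  rw [lp.coeFn_add]
  exact Set.indicator_self_add_compl s f

/-- Splitting `f` along a set of indices, the first part is estimated in `ℓ¹` and the second one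
in `ℓ²`. -/
theorem setLIntegral_enorm_fourierZ_sq_le {d : ℕ} (f : ellZ d 2) (s : Set (Fin d → ℤ))
    (E : Set (UnitAddTorus (Fin d))) :
    ∫⁻ ξ in E, ‖fourierZ f ξ‖ₑ ^ 2 ∂torusMeasure d ≤
      2 * (torusMeasure d E * (∑' n, s.indicator (fun n => ‖f n‖ₑ) n) ^ 2) +
        2 * ∑' n, sᶜ.indicator (fun n => ‖f n‖ₑ ^ 2) n := by
  set g := ellRestrict s f
  set h := ellRestrict sᶜ f
  have hg : ∑' n, ‖g n‖ₑ = ∑' n, s.indicator (fun n => ‖f n‖ₑ) n := by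
    refine tsum_congr fun n => ?_
    by_cases hn : n ∈ s <;> simp [g, ellRestrict_apply, hn]
  have hh : ∑' n, ‖h n‖ₑ ^ 2 = ∑' n, sᶜ.indicator (fun n => ‖f n‖ₑ ^ 2) n := by
    refine tsum_congr fun n => ?_
    by_cases hn : n ∈ s <;> simp [h, ellRestrict_apply, hn]
  have hpt : ∀ᵐ ξ ∂torusMeasure d, ‖fourierZ f ξ‖ₑ ^ 2 ≤
      2 * (∑' n, ‖g n‖ₑ) ^ 2 + 2 * ‖fourierZ h ξ‖ₑ ^ 2 := by
    have hadd : fourierZ f = fourierZ g + fourierZ h := by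
      rw [← fourierZ_add, ellRestrict_add_compl]
    filter_upwards [Lp.coeFn_add (fourierZ g) (fourierZ h), ae_enorm_fourierZ_le_tsum g]
      with ξ h1 h2
    rw [hadd, h1, Pi.add_apply]
    calc ‖fourierZ g ξ + fourierZ h ξ‖ₑ ^ 2
        ≤ (∑' n, ‖g n‖ₑ + ‖fourierZ h ξ‖ₑ) ^ 2 := by
          gcongr
          exact (enorm_add_le _ _).trans (by gcongr)
      _ ≤ 2 * ((∑' n, ‖g n‖ₑ) ^ 2 + ‖fourierZ h ξ‖ₑ ^ 2) := by
          have := ENNReal.rpow_add_le_mul_rpow_add_rpow (∑' n, ‖g n‖ₑ) ‖fourierZ h ξ‖ₑ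
            (p := 2) (by norm_num)
          norm_num at this
          simpa using this
      _ = _ := by ring
  calc ∫⁻ ξ in E, ‖fourierZ f ξ‖ₑ ^ 2 ∂torusMeasure d
      ≤ ∫⁻ ξ in E, (2 * (∑' n, ‖g n‖ₑ) ^ 2 + 2 * ‖fourierZ h ξ‖ₑ ^ 2) ∂torusMeasure d :=
        lintegral_mono_ae (ae_restrict_of_ae hpt)
    _ = 2 * (torusMeasure d E * (∑' n, ‖g n‖ₑ) ^ 2) +
          2 * ∫⁻ ξ in E, ‖fourierZ h ξ‖ₑ ^ 2 ∂torusMeasure d := by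
        rw [lintegral_add_left measurable_const, lintegral_const,
          lintegral_const_mul' _ _ (by simp), Measure.restrict_apply_univ]
        ring
    _ ≤ 2 * (torusMeasure d E * (∑' n, ‖g n‖ₑ) ^ 2) +
          2 * ∫⁻ ξ, ‖fourierZ h ξ‖ₑ ^ 2 ∂torusMeasure d := by
        gcongr
        exact Measure.restrict_le_self
    _ = _ := by rw [lintegral_enorm_fourierZ_sq, hg, hh]

/-! ### The weighted L² inequality -/

/-- The profile, as a function of the level `s`, of the contribution of a coefficient of modulus
`x` to the `ℓ¹`--`ℓ²` splitting at height `s ^ (-1 / (2 - p))`. -/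
noncomputable def levelProfile (p c x : ℝ) (s : ℝ) : ℝ≥0∞ :=
  (Set.Ioi (x ^ (p - 2))).indicator
      (fun s => ENNReal.ofReal (2 * c * x) * ENNReal.ofReal (s ^ (-1 / (2 - p)))) s +
    (Set.Ioc 0 (x ^ (p - 2))).indicator (fun _ => ENNReal.ofReal (2 * x ^ 2)) s

theorem measurable_levelProfile (p c x : ℝ) : Measurable (levelProfile p c x) := by
  unfold levelProfile
  refine Measurable.add (Measurable.indicator ?_ measurableSet_Ioi)
    (measurable_const.indicator measurableSet_Ioc)
  fun_prop

theorem lintegral_Ioi_ofReal_rpow {e a : ℝ} (he : e < -1) (ha : 0 < a) :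
    ∫⁻ s in Set.Ioi a, ENNReal.ofReal (s ^ e) = ENNReal.ofReal (-a ^ (e + 1) / (e + 1)) := by
  rw [← integral_Ioi_rpow_of_lt he ha,
    ofReal_integral_eq_lintegral_ofReal (integrableOn_Ioi_rpow_of_lt he ha)]
  filter_upwards [self_mem_ae_restrict measurableSet_Ioi] with s hs
  exact Real.rpow_nonneg (ha.trans hs).le _

/-- The two pieces scale alike: x ∫ s^{-1/(2-p)} ds over s > x^{p-2} is a multiple of x · x^{p-1},
and x² times the length x^{p-2} is x^p. -/
theorem lintegral_levelProfile {p c x : ℝ} (hp1 : 1 < p) (hp2 : p < 2) (hc : 0 < c) (hx : 0 ≤ x) :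
    ∫⁻ s, levelProfile p c x s =
      ENNReal.ofReal (2 * c * ((2 - p) / (p - 1)) + 2) * ENNReal.ofReal (x ^ p) := by
  rcases hx.eq_or_lt with rfl | hx
  · simp [levelProfile, Real.zero_rpow (by linarith : p ≠ 0)]
  have h2p : 0 < 2 - p := by linarith
  have hp1' : 0 < p - 1 := by linarith
  -- This is where p > 1 enters: it makes the tail in s integrable.
  have he : -1 / (2 - p) < -1 := by
    rw [div_lt_iff₀ h2p]
    linarith
  have ha : 0 < x ^ (p - 2) := Real.rpow_pos_of_pos hx _
  have hee : -1 / (2 - p) + 1 = -((p - 1) / (2 - p)) := by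
    field_simp
    ring
  have hpow : (x ^ (p - 2)) ^ (-1 / (2 - p) + 1) = x ^ (p - 1) := by
    rw [← Real.rpow_mul hx.le, hee]
    congr 1
    field_simp
    ring
  unfold levelProfile
  rw [lintegral_add_right _ (measurable_const.indicator measurableSet_Ioc),
    lintegral_indicator measurableSet_Ioi, lintegral_indicator measurableSet_Ioc,
    lintegral_const_mul' _ _ ENNReal.ofReal_ne_top, lintegral_Ioi_ofReal_rpow he ha,
    setLIntegral_const, Real.volume_Ioc, hpow, hee,
    ← ENNReal.ofReal_mul (by positivity), ← ENNReal.ofReal_mul (by positivity),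
    ← ENNReal.ofReal_mul (by positivity), ← ENNReal.ofReal_add ?_ (by positivity)]
  · congr 1
    have e1 : x ^ p = x * x ^ (p - 1) := by
      rw [← Real.rpow_one_add' hx.le (by linarith)]
      congr 1
      ring
    have e2 : x ^ p = x ^ 2 * x ^ (p - 2) := by
      rw [← Real.rpow_natCast, ← Real.rpow_add hx]
      congr 1
      push_cast
      ring
    rw [add_mul, sub_zero, mul_assoc 2 (x ^ 2), ← e2, e1]
    field_simp
  · rw [neg_div_neg_eq]
    positivity

/-- Chebyshev: where |f(n)| > l, |f(n)| ≤ l^{1-p} |f(n)|^p. -/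
theorem tsum_indicator_enorm_le {ι : Type*} {p l : ℝ} (hp : 1 < p) (hl : 0 < l) (f : ι → ℂ)
    (hf : ∑' n, ‖f n‖ₑ ^ p ≤ 1) :
    ∑' n, {n | l < ‖f n‖}.indicator (fun n => ‖f n‖ₑ) n ≤ ENNReal.ofReal (l ^ (1 - p)) := by
  calc ∑' n, {n | l < ‖f n‖}.indicator (fun n => ‖f n‖ₑ) n
      ≤ ∑' n, ENNReal.ofReal (l ^ (1 - p)) * ‖f n‖ₑ ^ p := by
        refine ENNReal.tsum_le_tsum fun n => Set.indicator_apply_le' (fun hn => ?_) (by simp)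
        have hn : l < ‖f n‖ := hn
        have h0 : 0 < ‖f n‖ := hl.trans hn
        rw [← ofReal_norm, ENNReal.ofReal_rpow_of_nonneg h0.le (by linarith),
          ← ENNReal.ofReal_mul (by positivity)]
        refine ENNReal.ofReal_le_ofReal ?_
        calc ‖f n‖ = ‖f n‖ ^ (1 - p) * ‖f n‖ ^ p := by
              rw [← Real.rpow_add h0]
              simp
          _ ≤ l ^ (1 - p) * ‖f n‖ ^ p := by
              gcongr ?_ * _
              exact Real.rpow_le_rpow_of_nonpos hl hn.le (by linarith)
    _ ≤ ENNReal.ofReal (l ^ (1 - p)) * 1 := by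
        rw [ENNReal.tsum_mul_left]
        gcongr
    _ = _ := mul_one _

theorem rpow_lt_iff_lt_rpow_sub_two {p s x : ℝ} (hp2 : p < 2) (hs : 0 < s) (hx : 0 < x) :
    s ^ (-1 / (2 - p)) < x ↔ x ^ (p - 2) < s := by
  have h2p : 0 < 2 - p := by linarith
  have h := Real.rpow_lt_rpow_iff_of_neg (x := x) (y := s ^ (-1 / (2 - p))) (z := p - 2)
    hx (Real.rpow_pos_of_pos hs _) (by linarith)
  rw [← h, ← Real.rpow_mul hs.le]
  have : -1 / (2 - p) * (p - 2) = 1 := by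
    field_simp
    ring
  rw [this, Real.rpow_one]

/-- The weighted inequality `∫ u |𝓕f|² ≤ C ‖f‖_p²` on the unit sphere of `ℓ^p`, for `1 < p < 2` and
a weight `u` in the weak Lebesgue space of exponent `p / (2 - p)`. -/
theorem lintegral_weight_mul_fourierZ_sq_le {d : ℕ} {p c : ℝ} (hp1 : 1 < p) (hp2 : p < 2)
    (hc : 0 < c) {u : UnitAddTorus (Fin d) → ℝ} (hu0 : ∀ ξ, 0 ≤ u ξ)
    (hum : AEMeasurable u (torusMeasure d))
    (hu : ∀ s : ℝ, 0 < s →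
      torusMeasure d {ξ | s ≤ u ξ} ≤ ENNReal.ofReal (c / s ^ (p / (2 - p))))
    (f : ellZ d 2) (hf : ∑' n, ‖f n‖ₑ ^ p ≤ 1) :
    ∫⁻ ξ, ENNReal.ofReal (u ξ) * ‖fourierZ f ξ‖ₑ ^ 2 ∂torusMeasure d ≤
      ENNReal.ofReal (2 * c * ((2 - p) / (p - 1)) + 2) := by
  have h2p : 0 < 2 - p := by linarith
  have hFm : AEMeasurable (fun ξ => ‖fourierZ f ξ‖ₑ ^ 2) (torusMeasure d) :=
    (Lp.aestronglyMeasurable (fourierZ f)).enorm.pow_const 2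
  have hlevel : ∀ s : ℝ, 0 < s →
      ∫⁻ ξ in {ξ | s ≤ u ξ}, ‖fourierZ f ξ‖ₑ ^ 2 ∂torusMeasure d ≤
        ∑' n, levelProfile p c ‖f n‖ s := by
    intro s hs
    -- The height at which, up to c, the two contributions s^{-p/(2-p)} l^{1-p} · l and l² of a
    -- coefficient of modulus l balance.
    set l : ℝ := s ^ (-1 / (2 - p)) with hl
    have hl0 : 0 < l := Real.rpow_pos_of_pos hs _
    set S : Set (Fin d → ℤ) := {n | l < ‖f n‖} with hS
    have hexp : c / s ^ (p / (2 - p)) * l ^ (1 - p) = c * s ^ (-1 / (2 - p)) := by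
      rw [hl, ← Real.rpow_mul hs.le, div_eq_mul_inv, ← Real.rpow_neg hs.le, mul_assoc,
        ← Real.rpow_add hs]
      congr 2
      field_simp
      ring
    calc ∫⁻ ξ in {ξ | s ≤ u ξ}, ‖fourierZ f ξ‖ₑ ^ 2 ∂torusMeasure d
        ≤ _ := setLIntegral_enorm_fourierZ_sq_le f S _
      -- Only one of the two ℓ¹ factors is estimated by l^{1-p}; keeping the other makes the bound
      -- additive over coefficients.
      _ ≤ 2 * (ENNReal.ofReal (c / s ^ (p / (2 - p))) * (ENNReal.ofReal (l ^ (1 - p)) *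
            ∑' n, S.indicator (fun n => ‖f n‖ₑ) n)) +
          2 * ∑' n, Sᶜ.indicator (fun n => ‖f n‖ₑ ^ 2) n := by
          rw [sq]
          gcongr
          · exact hu s hs
          · exact tsum_indicator_enorm_le hp1 hl0 f hf
      _ = ∑' n, (2 * ENNReal.ofReal (c * s ^ (-1 / (2 - p))) *
            S.indicator (fun n => ‖f n‖ₑ) n + 2 * Sᶜ.indicator (fun n => ‖f n‖ₑ ^ 2) n) := by
          rw [ENNReal.tsum_add, ENNReal.tsum_mul_left, ENNReal.tsum_mul_left, ← hexp,
            ENNReal.ofReal_mul (by positivity)]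
          ring
      _ ≤ ∑' n, levelProfile p c ‖f n‖ s := by
          refine ENNReal.tsum_le_tsum fun n => ?_
          rcases (norm_nonneg (f n)).eq_or_lt with h0 | h0
          · have : f n = 0 := norm_eq_zero.1 h0.symm
            have hn : n ∉ S := by simp [hS, this, hl0.le]
            simp [hn, this]
          have hiff := rpow_lt_iff_lt_rpow_sub_two hp2 hs h0
          unfold levelProfile
          by_cases hn : n ∈ S
          · have hlt : ‖f n‖ ^ (p - 2) < s := hiff.1 hn
            rw [Set.indicator_of_mem hn, Set.indicator_of_notMem (by simpa using hn),
              Set.indicator_of_mem (Set.mem_Ioi.2 hlt), Set.indicator_of_notMem (by simp [hlt]),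
              mul_zero, ← ofReal_norm, ENNReal.ofReal_mul hc.le, ENNReal.ofReal_mul (by positivity),
              ENNReal.ofReal_mul (by norm_num), ENNReal.ofReal_ofNat]
            exact le_of_eq (by ring)
          · have hle : s ≤ ‖f n‖ ^ (p - 2) := not_lt.1 fun h => hn (hiff.2 h)
            rw [Set.indicator_of_notMem hn, Set.indicator_of_mem (Set.mem_compl hn),
              Set.indicator_of_notMem (by simpa using hle),
              Set.indicator_of_mem (Set.mem_Ioc.2 ⟨hs, hle⟩), mul_zero, zero_add, zero_add,
              ← ofReal_norm, ENNReal.ofReal_mul (by norm_num), ENNReal.ofReal_pow h0.le]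
            simp
  calc ∫⁻ ξ, ENNReal.ofReal (u ξ) * ‖fourierZ f ξ‖ₑ ^ 2 ∂torusMeasure d
      = ∫⁻ ξ, ENNReal.ofReal (u ξ)
          ∂(torusMeasure d).withDensity fun ξ => ‖fourierZ f ξ‖ₑ ^ 2 := by
        rw [lintegral_withDensity_eq_lintegral_mul₀ hFm hum.ennreal_ofReal]
        simp only [Pi.mul_apply, mul_comm]
    _ = ∫⁻ s in Set.Ioi 0, ∫⁻ ξ in {ξ | s ≤ u ξ}, ‖fourierZ f ξ‖ₑ ^ 2 ∂torusMeasure d := by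
        -- Layer cake for u with respect to the measure |𝓕f|² dξ.
        rw [lintegral_eq_lintegral_meas_le _ (Filter.Eventually.of_forall hu0)
          (hum.mono_ac (withDensity_absolutelyContinuous _ _))]
        simp only [withDensity_apply']
    _ ≤ ∫⁻ s in Set.Ioi 0, ∑' n, levelProfile p c ‖f n‖ s :=
        setLIntegral_mono' measurableSet_Ioi hlevel
    _ ≤ ∫⁻ s, ∑' n, levelProfile p c ‖f n‖ s := setLIntegral_le_lintegral _ _
    _ = ∑' n, ∫⁻ s, levelProfile p c ‖f n‖ s :=
        lintegral_tsum fun n => (measurable_levelProfile _ _ _).aemeasurable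
    _ = ∑' n, ENNReal.ofReal (2 * c * ((2 - p) / (p - 1)) + 2) * ‖f n‖ₑ ^ p := by
        refine tsum_congr fun n => ?_
        rw [lintegral_levelProfile hp1 hp2 hc (norm_nonneg _), ← ofReal_norm,
          ENNReal.ofReal_rpow_of_nonneg (norm_nonneg _) (by linarith)]
    _ ≤ ENNReal.ofReal (2 * c * ((2 - p) / (p - 1)) + 2) * 1 := by
        rw [ENNReal.tsum_mul_left]
        gcongr
    _ = _ := mul_one _

/-! ### Powers of |m| as weights, and the trilinear estimate -/

/-- Since 2θ = α(2-p)/p, the power |m|^{2θ} lies in weak L^{p/(2-p)}, as the weighted inequality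
requires. -/
theorem exists_lintegral_norm_rpow_mul_fourierZ_sq_le {d : ℕ} {α p θ : ℝ} (hα : 0 < α)
    {m : UnitAddTorus (Fin d) → ℂ} (hm : MemWeakL m α) (hp1 : 1 < p) (hp2 : p ≤ 2)
    (hθ : θ = α * (1 / p - 1 / 2)) :
    ∃ C : ℝ≥0∞, C ≠ ∞ ∧ ∀ f : ellZ d 2, ∑' n, ‖f n‖ₑ ^ p ≤ 1 →
      ∫⁻ ξ, ENNReal.ofReal (‖m ξ‖ ^ (2 * θ)) * ‖fourierZ f ξ‖ₑ ^ 2 ∂torusMeasure d ≤ C := by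
  obtain ⟨hmeas, c, hc, hmc⟩ := hm
  rcases hp2.eq_or_lt with rfl | hp2
  · refine ⟨1, by simp, fun f hf => ?_⟩
    -- At p = 2 the weight is identically 1 (also where m = 0, as 0^0 = 1), and Parseval suffices.
    have hθ0 : θ = 0 := by simp [hθ]
    simp only [hθ0, mul_zero, Real.rpow_zero, ENNReal.ofReal_one, one_mul]
    rw [lintegral_enorm_fourierZ_sq]
    simpa using hf
  have h2p : 0 < 2 - p := by linarith
  have hp0 : 0 < p := by linarith
  have hθ2 : 2 * θ = α * ((2 - p) / p) := by
    rw [hθ]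
    field_simp
  have hθpos : 0 < 2 * θ := by
    rw [hθ2]
    positivity
  refine ⟨_, ENNReal.ofReal_ne_top, fun f hf =>
    lintegral_weight_mul_fourierZ_sq_le hp1 hp2 hc (fun ξ => by positivity)
      (hmeas.norm.aemeasurable.pow_const _) (fun s hs => ?_) f hf⟩
  have hset : {ξ | s ≤ ‖m ξ‖ ^ (2 * θ)} = {ξ | s ^ (2 * θ)⁻¹ ≤ ‖m ξ‖} := by
    ext ξ
    exact (Real.rpow_inv_le_iff_of_pos hs.le (norm_nonneg _) hθpos).symm
  rw [hset]
  refine (hmc _ (Real.rpow_pos_of_pos hs _)).trans_eq ?_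
  rw [← Real.rpow_mul hs.le, hθ2]
  congr 3
  field_simp

/-- The trilinear estimate `∫ |m| |𝓕f| |𝓕g| ≤ C ‖f‖_p ‖g‖_r` on unit spheres. -/
theorem exists_lintegral_mul_fourierZ_mul_fourierZ_le {d : ℕ} {α p r : ℝ} (hα : 0 < α)
    {m : UnitAddTorus (Fin d) → ℂ} (hm : MemWeakL m α) (hp1 : 1 < p) (hp2 : p ≤ 2)
    (hr1 : 1 < r) (hr2 : r ≤ 2) (hpr : 1 / p + 1 / r = 1 + 1 / α) :
    ∃ C : ℝ≥0∞, C ≠ ∞ ∧ ∀ f g : ellZ d 2, ∑' n, ‖f n‖ₑ ^ p ≤ 1 → ∑' n, ‖g n‖ₑ ^ r ≤ 1 →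
      ∫⁻ ξ, ‖symbolMul m f ξ‖ₑ * ‖fourierZ g ξ‖ₑ ∂torusMeasure d ≤ C := by
  obtain ⟨A, hA, hAf⟩ := exists_lintegral_norm_rpow_mul_fourierZ_sq_le hα hm hp1 hp2 rfl
  obtain ⟨B, hB, hBg⟩ := exists_lintegral_norm_rpow_mul_fourierZ_sq_le hα hm hr1 hr2 rfl
  set θ := α * (1 / p - 1 / 2) with hθ
  set η := α * (1 / r - 1 / 2) with hη
  have hsum : θ + η = 1 := by
    have : θ + η = α * (1 / p + 1 / r - 1) := by rw [hθ, hη]; ring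
    rw [this, hpr]
    field_simp
    ring
  refine ⟨A ^ (1 / 2 : ℝ) * B ^ (1 / 2 : ℝ), by finiteness, fun f g hf hg => ?_⟩
  have hmeas : ∀ (t : ℝ) (f : ellZ d 2), AEMeasurable
      (fun ξ => ENNReal.ofReal (‖m ξ‖ ^ t) * ‖fourierZ f ξ‖ₑ) (torusMeasure d) := fun t f =>
    (hm.1.norm.aemeasurable.pow_const t).ennreal_ofReal.mul
      (Lp.aestronglyMeasurable (fourierZ f)).enorm
  have hsq : ∀ (t : ℝ) (f : ellZ d 2) (ξ),
      (ENNReal.ofReal (‖m ξ‖ ^ t) * ‖fourierZ f ξ‖ₑ) ^ (2 : ℝ) =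
        ENNReal.ofReal (‖m ξ‖ ^ (2 * t)) * ‖fourierZ f ξ‖ₑ ^ 2 := by
    intro t f ξ
    rw [ENNReal.rpow_ofNat, mul_pow, ← ENNReal.ofReal_pow (by positivity), mul_comm 2 t,
      Real.rpow_mul (norm_nonneg _), Real.rpow_ofNat]
  calc ∫⁻ ξ, ‖symbolMul m f ξ‖ₑ * ‖fourierZ g ξ‖ₑ ∂torusMeasure d
      = ∫⁻ ξ, ((fun ξ => ENNReal.ofReal (‖m ξ‖ ^ θ) * ‖fourierZ f ξ‖ₑ) *
          fun ξ => ENNReal.ofReal (‖m ξ‖ ^ η) * ‖fourierZ g ξ‖ₑ) ξ ∂torusMeasure d := by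
        refine lintegral_congr fun ξ => ?_
        -- Also valid where m vanishes, because θ + η = 1 is nonzero.
        have : ‖m ξ‖ₑ = ENNReal.ofReal (‖m ξ‖ ^ θ) * ENNReal.ofReal (‖m ξ‖ ^ η) := by
          rw [← ENNReal.ofReal_mul (by positivity),
            ← Real.rpow_add' (norm_nonneg _) (by simp [hsum]), hsum, Real.rpow_one, ofReal_norm]
        simp only [symbolMul, enorm_mul, Pi.mul_apply, this]
        ring
    _ ≤ _ := ENNReal.lintegral_mul_le_Lp_mul_Lq _ Real.HolderConjugate.two_two
        (hmeas θ f) (hmeas η g)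
    _ ≤ A ^ (1 / 2 : ℝ) * B ^ (1 / 2 : ℝ) := by
        simp only [hsq]
        gcongr
        · exact hAf f hf
        · exact hBg g hg

/-! ### Duality: integrability and the ℓ^q bound -/

/-- The converse of Hölder's inequality for finite sums. -/
theorem sum_norm_rpow_le_of_forall_norm_sum_mul_le {ι : Type*} {q r C : ℝ}
    (hqr : q.HolderConjugate r) (s : Finset ι) (a : ι → ℂ)
    (h : ∀ g : ι → ℂ, ∑ i ∈ s, ‖g i‖ ^ r ≤ 1 → ‖∑ i ∈ s, g i * a i‖ ≤ C) :
    ∑ i ∈ s, ‖a i‖ ^ q ≤ C ^ q := by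
  obtain ⟨⟨g, hg, hge⟩, -⟩ := NNReal.isGreatest_Lp s (fun i => ‖a i‖₊) hqr
  -- The nonnegative extremiser g for the moduli, multiplied by the conjugate phase of a.
  set b : ι → ℂ := fun i => (g i : ℂ) * (if a i = 0 then 0 else star (a i) / ‖a i‖) with hb
  have hba : ∀ i, b i * a i = ((‖a i‖ * g i : ℝ) : ℂ) := by
    intro i
    by_cases hi : a i = 0
    · simp [hi]
    · have hn : (‖a i‖ : ℂ) ≠ 0 := by simpa using hi
      have hc : star (a i) * a i = (‖a i‖ : ℂ) ^ 2 := Complex.conj_mul' (a i)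
      simp only [hb, hi, if_false]
      push_cast
      field_simp
      linear_combination (g i : ℂ) * hc
  have hbn : ∀ i, ‖b i‖ ≤ g i := by
    intro i
    by_cases hi : a i = 0
    · simp [hb, hi]
    · simp [hb, hi]
  have hgr : ∑ i ∈ s, (g i : ℝ) ^ r ≤ 1 := by exact_mod_cast hg
  have hC := h b ((Finset.sum_le_sum fun i _ =>
    Real.rpow_le_rpow (norm_nonneg _) (hbn i) hqr.symm.nonneg).trans hgr)
  have hge' : ∑ i ∈ s, ‖a i‖ * g i = (∑ i ∈ s, ‖a i‖ ^ q) ^ (1 / q) := by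
    have := congrArg NNReal.toReal hge
    push_cast at this
    exact this
  have h0 : 0 ≤ ∑ i ∈ s, ‖a i‖ ^ q := by positivity
  simp only [hba] at hC
  rw [← Complex.ofReal_sum, hge', Complex.norm_real, Real.norm_of_nonneg (by positivity)] at hC
  calc ∑ i ∈ s, ‖a i‖ ^ q = ((∑ i ∈ s, ‖a i‖ ^ q) ^ (1 / q)) ^ q := by
        rw [← Real.rpow_mul h0, one_div_mul_cancel hqr.ne_zero, Real.rpow_one]
    _ ≤ C ^ q := Real.rpow_le_rpow (by positivity) hC hqr.nonneg

/-- The element of `ℓ²(ℤ^d)` that agrees with `g` on the finite set `s` and vanishes elsewhere. -/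
noncomputable def ellOfFinset {d : ℕ} (s : Finset (Fin d → ℤ)) (g : (Fin d → ℤ) → ℂ) : ellZ d 2 :=
  ⟨(s : Set (Fin d → ℤ)).indicator g, (memℓp_zero (s.finite_toSet.subset fun n hn => by
    by_contra h
    exact hn (Set.indicator_of_notMem h g))).of_exponent_ge zero_le⟩

theorem ellOfFinset_apply {d : ℕ} (s : Finset (Fin d → ℤ)) (g : (Fin d → ℤ) → ℂ)
    (n : Fin d → ℤ) : ellOfFinset s g n = (s : Set (Fin d → ℤ)).indicator g n := rfl

theorem tsum_enorm_ellOfFinset_rpow {d : ℕ} {r : ℝ} (hr : 0 < r) (s : Finset (Fin d → ℤ))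
    (g : (Fin d → ℤ) → ℂ) :
    ∑' n, ‖ellOfFinset s g n‖ₑ ^ r = ENNReal.ofReal (∑ n ∈ s, ‖g n‖ ^ r) := by
  rw [tsum_eq_sum (s := s) fun n hn => by simp [ellOfFinset_apply, hn, hr],
    ENNReal.ofReal_sum_of_nonneg fun n _ => by positivity]
  refine Finset.sum_congr rfl fun n hn => ?_
  rw [ellOfFinset_apply, Set.indicator_of_mem (by simpa using hn), ← ofReal_norm,
    ENNReal.ofReal_rpow_of_nonneg (norm_nonneg _) hr.le]

theorem fourierZ_ellOfFinset {d : ℕ} (s : Finset (Fin d → ℤ)) (g : (Fin d → ℤ) → ℂ) :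
    fourierZ (ellOfFinset s g) =ᵐ[torusMeasure d]
      fun ξ => ∑ n ∈ s, g n * UnitAddTorus.mFourier n ξ := by
  filter_upwards [coeFn_fourierZ_of_support_subset (ellOfFinset s g) s
    fun n hn => by simp [ellOfFinset_apply, hn]] with ξ hξ
  rw [hξ]
  refine Finset.sum_congr rfl fun n hn => ?_
  rw [ellOfFinset_apply, Set.indicator_of_mem (by simpa using hn)]

theorem aestronglyMeasurable_symbolMul {d : ℕ} {m : UnitAddTorus (Fin d) → ℂ}
    (hm : AEStronglyMeasurable m (torusMeasure d)) (f : ellZ d 2) :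
    AEStronglyMeasurable (symbolMul m f) (torusMeasure d) :=
  hm.mul (Lp.aestronglyMeasurable (fourierZ f))

theorem integrable_symbolMul_of_lintegral_le {d : ℕ} {m : UnitAddTorus (Fin d) → ℂ} {r : ℝ}
    (hr : 0 < r) (hm : AEStronglyMeasurable m (torusMeasure d)) {C : ℝ≥0∞} (hC : C ≠ ∞)
    (f : ellZ d 2)
    (h : ∀ g : ellZ d 2, ∑' n, ‖g n‖ₑ ^ r ≤ 1 →
      ∫⁻ ξ, ‖symbolMul m f ξ‖ₑ * ‖fourierZ g ξ‖ₑ ∂torusMeasure d ≤ C) :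
    Integrable (symbolMul m f) (torusMeasure d) := by
  refine ⟨aestronglyMeasurable_symbolMul hm f, ?_⟩
  -- Test against the unit mass at 0, whose Fourier transform is 1.
  have h1 := h (ellOfFinset {0} 1) (by rw [tsum_enorm_ellOfFinset_rpow hr]; simp)
  have h2 : ∫⁻ ξ, ‖symbolMul m f ξ‖ₑ * ‖fourierZ (ellOfFinset {0} 1) ξ‖ₑ ∂torusMeasure d =
      ∫⁻ ξ, ‖symbolMul m f ξ‖ₑ ∂torusMeasure d := by
    refine lintegral_congr_ae ?_
    filter_upwards [fourierZ_ellOfFinset {0} (1 : (Fin d → ℤ) → ℂ)] with ξ hξ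
    rw [hξ]
    simp [UnitAddTorus.mFourier_zero]
  rw [h2] at h1
  exact h1.trans_lt hC.lt_top

theorem integrable_mFourier_mul {d : ℕ} {F : UnitAddTorus (Fin d) → ℂ}
    (hF : Integrable F (torusMeasure d)) (n : Fin d → ℤ) :
    Integrable (fun ξ => UnitAddTorus.mFourier n ξ * F ξ) (torusMeasure d) := by
  refine hF.bdd_mul (c := 1) (UnitAddTorus.mFourier n).continuous.aestronglyMeasurable
    (Filter.Eventually.of_forall fun ξ => ?_)
  exact (ContinuousMap.norm_coe_le_norm _ ξ).trans_eq UnitAddTorus.mFourier_norm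

theorem multiplierT_eq_integral {d : ℕ} (m : UnitAddTorus (Fin d) → ℂ) (f : ellZ d 2)
    (n : Fin d → ℤ) :
    multiplierT m f n =
      ∫ ξ, UnitAddTorus.mFourier (-n) ξ * symbolMul m f ξ ∂torusMeasure d := rfl

/-- Pairing with 𝓕g without conjugation produces the coefficients at -n; the reflection is harmless
for ℓ^q norms. -/
theorem sum_mul_multiplierT_neg {d : ℕ} {m : UnitAddTorus (Fin d) → ℂ} {f : ellZ d 2}
    (hf : Integrable (symbolMul m f) (torusMeasure d)) (s : Finset (Fin d → ℤ))
    (g : (Fin d → ℤ) → ℂ) :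
    ∑ n ∈ s, g n * multiplierT m f (-n) =
      ∫ ξ, symbolMul m f ξ * fourierZ (ellOfFinset s g) ξ ∂torusMeasure d := by
  have h : (fun ξ => symbolMul m f ξ * fourierZ (ellOfFinset s g) ξ) =ᵐ[torusMeasure d]
      fun ξ => ∑ n ∈ s, g n * (UnitAddTorus.mFourier n ξ * symbolMul m f ξ) := by
    filter_upwards [fourierZ_ellOfFinset s g] with ξ hξ
    rw [hξ, Finset.mul_sum]
    exact Finset.sum_congr rfl fun n _ => by ring
  rw [integral_congr_ae h,
    integral_finsetSum _ fun n _ => (integrable_mFourier_mul hf n).const_mul (g n)]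
  refine Finset.sum_congr rfl fun n _ => ?_
  rw [integral_const_mul, multiplierT_eq_integral, neg_neg]

theorem sum_norm_multiplierT_rpow_le {d : ℕ} {m : UnitAddTorus (Fin d) → ℂ} {q r : ℝ}
    (hqr : q.HolderConjugate r) {C : ℝ≥0∞} (hC : C ≠ ∞) {f : ellZ d 2}
    (hf : Integrable (symbolMul m f) (torusMeasure d))
    (h : ∀ g : ellZ d 2, ∑' n, ‖g n‖ₑ ^ r ≤ 1 →
      ∫⁻ ξ, ‖symbolMul m f ξ‖ₑ * ‖fourierZ g ξ‖ₑ ∂torusMeasure d ≤ C)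
    (s : Finset (Fin d → ℤ)) :
    ∑ n ∈ s, ‖multiplierT m f n‖ ^ q ≤ C.toReal ^ q := by
  have key : ∀ s : Finset (Fin d → ℤ),
      ∑ n ∈ s, ‖multiplierT m f (-n)‖ ^ q ≤ C.toReal ^ q := by
    intro s
    refine sum_norm_rpow_le_of_forall_norm_sum_mul_le hqr s (fun n => multiplierT m f (-n))
      fun g hg => ?_
    rw [sum_mul_multiplierT_neg hf]
    refine (norm_integral_le_lintegral_norm _).trans (ENNReal.toReal_mono hC ?_)
    simp only [ofReal_norm, enorm_mul]
    refine h _ ?_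
    rw [tsum_enorm_ellOfFinset_rpow hqr.symm.pos]
    simpa using hg
  simpa using key (s.map (Equiv.neg _).toEmbedding)

/-! ### Linearity and passage to operators on ℓ^p -/

theorem symbolMul_add_ae {d : ℕ} (m : UnitAddTorus (Fin d) → ℂ) (f g : ellZ d 2) :
    symbolMul m (f + g) =ᵐ[torusMeasure d] symbolMul m f + symbolMul m g := by
  filter_upwards [Lp.coeFn_add (fourierZ f) (fourierZ g)] with ξ hξ
  simp only [symbolMul, fourierZ_add, hξ, Pi.add_apply, mul_add]

theorem symbolMul_smul_ae {d : ℕ} (m : UnitAddTorus (Fin d) → ℂ) (c : ℂ) (f : ellZ d 2) :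
    symbolMul m (c • f) =ᵐ[torusMeasure d] c • symbolMul m f := by
  filter_upwards [Lp.coeFn_smul c (fourierZ f)] with ξ hξ
  simp only [symbolMul, fourierZ_smul, hξ, Pi.smul_apply, smul_eq_mul]
  ring

theorem multiplierT_add {d : ℕ} {m : UnitAddTorus (Fin d) → ℂ} {f g : ellZ d 2}
    (hf : Integrable (symbolMul m f) (torusMeasure d))
    (hg : Integrable (symbolMul m g) (torusMeasure d)) :
    multiplierT m (f + g) = multiplierT m f + multiplierT m g := by
  ext n
  simp only [Pi.add_apply, multiplierT_eq_integral]
  rw [← integral_add (integrable_mFourier_mul hf _) (integrable_mFourier_mul hg _)]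
  refine integral_congr_ae ?_
  filter_upwards [symbolMul_add_ae m f g] with ξ hξ
  rw [hξ, Pi.add_apply, mul_add]

theorem multiplierT_smul {d : ℕ} (m : UnitAddTorus (Fin d) → ℂ) (c : ℂ) (f : ellZ d 2) :
    multiplierT m (c • f) = c • multiplierT m f := by
  ext n
  simp only [Pi.smul_apply, multiplierT_eq_integral, smul_eq_mul]
  rw [← integral_const_mul]
  refine integral_congr_ae ?_
  filter_upwards [symbolMul_smul_ae m c f] with ξ hξ
  rw [hξ, Pi.smul_apply, smul_eq_mul]
  ring

theorem toEll2_add {d : ℕ} {p : ℝ≥0∞} (hp : p ≤ 2) (f g : ellZ d p) :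
    toEll2 hp (f + g) = toEll2 hp f + toEll2 hp g := rfl

theorem toEll2_smul {d : ℕ} {p : ℝ≥0∞} (hp : p ≤ 2) (c : ℂ) (f : ellZ d p) :
    toEll2 hp (c • f) = c • toEll2 hp f := rfl

theorem toEll2_apply {d : ℕ} {p : ℝ≥0∞} (hp : p ≤ 2) (f : ellZ d p) (n : Fin d → ℤ) :
    toEll2 hp f n = f n := rfl

theorem tsum_enorm_rpow_eq {d : ℕ} {p : ℝ≥0∞} (hp : 0 < p.toReal) (f : ellZ d p) :
    ∑' n, ‖f n‖ₑ ^ p.toReal = ENNReal.ofReal (‖f‖ ^ p.toReal) := by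
  have h := lp.hasSum_norm hp f
  rw [← h.tsum_eq, ENNReal.ofReal_tsum_of_nonneg (fun n => by positivity) h.summable]
  refine tsum_congr fun n => ?_
  rw [← ofReal_norm, ENNReal.ofReal_rpow_of_nonneg (norm_nonneg _) hp.le]

/-- A linear operator into functions on `ℤ^d` whose values have controlled `ℓ^q` norms is a bounded
operator into `ℓ^q(ℤ^d)`. -/
theorem exists_continuousLinearMap_of_sum_norm_rpow_le {d : ℕ} {p q : ℝ≥0∞} [Fact (1 ≤ p)]
    [Fact (1 ≤ q)] (hq : 0 < q.toReal) {C : ℝ} (hC : 0 ≤ C) (F : ellZ d p → (Fin d → ℤ) → ℂ)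
    (hadd : ∀ f g, F (f + g) = F f + F g) (hsmul : ∀ (c : ℂ) f, F (c • f) = c • F f)
    (hF : ∀ f (s : Finset (Fin d → ℤ)), ∑ n ∈ s, ‖F f n‖ ^ q.toReal ≤ (C * ‖f‖) ^ q.toReal) :
    ∃ T : ellZ d p →L[ℂ] ellZ d q, ∀ (f : ellZ d p) (n : Fin d → ℤ), T f n = F f n := by
  let T : ellZ d p →ₗ[ℂ] ellZ d q :=
    { toFun := fun f => ⟨F f, memℓp_gen' (hF f)⟩
      map_add' := fun f g => lp.ext (hadd f g)
      map_smul' := fun c f => lp.ext (hsmul c f) }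
  exact ⟨T.mkContinuous C fun f => lp.norm_le_of_forall_sum_le hq (by positivity) (hF f),
    fun f n => rfl⟩

/-- If `m ∈ L^{α,∞}(𝕋^d)`, `α > 1`, `1 < p ≤ 2 ≤ q < ∞` and `1/p - 1/q = 1/α`, then `T_m` is
well defined on `ℓ^p(ℤ^d)` and is a bounded linear operator from `ℓ^p(ℤ^d)` to `ℓ^q(ℤ^d)`. -/
theorem mainTheorem2 (d : ℕ) (α : ℝ) (hα : 1 < α)
    (m : UnitAddTorus (Fin d) → ℂ) (hm : MemWeakL m α)
    (p q : ℝ≥0∞) [Fact (1 ≤ p)] [Fact (1 ≤ q)]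
    (hp1 : 1 < p) (hp2 : p ≤ 2) (hq2 : 2 ≤ q) (hq : q < ∞)
    (hpq : 1 / p.toReal - 1 / q.toReal = 1 / α) :
    (∀ f : ellZ d p, Integrable (symbolMul m (toEll2 hp2 f)) (torusMeasure d)) ∧
      ∃ T : ellZ d p →L[ℂ] ellZ d q,
        ∀ (f : ellZ d p) (n : Fin d → ℤ), T f n = multiplierT m (toEll2 hp2 f) n := by
  have hptop : p ≠ ∞ := (hp2.trans_lt (by simp)).ne
  have hP1 : 1 < p.toReal := by
    simpa using (ENNReal.toReal_lt_toReal (by simp) hptop).2 hp1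
  have hP2 : p.toReal ≤ 2 := by
    simpa using (ENNReal.toReal_le_toReal hptop (by simp)).2 hp2
  have hQ2 : 2 ≤ q.toReal := by
    simpa using (ENNReal.toReal_le_toReal (by simp) hq.ne).2 hq2
  have hP0 : 0 < p.toReal := by linarith
  have hQ0 : 0 < q.toReal := by linarith
  set r : ℝ := q.toReal.conjExponent with hr
  have hqr : q.toReal.HolderConjugate r := Real.HolderConjugate.conjExponent (by linarith)
  have hinv : 1 / r = 1 - 1 / q.toReal := by
    have := hqr.inv_add_inv_eq_one
    simp only [one_div]
    linarith
  have hr2 : r ≤ 2 := by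
    rw [hr, Real.conjExponent, div_le_iff₀ (by linarith)]
    linarith
  obtain ⟨C, hC, hCfg⟩ := exists_lintegral_mul_fourierZ_mul_fourierZ_le (by linarith) hm hP1 hP2
    hqr.symm.lt hr2 (by rw [hinv]; linarith)
  -- The estimates so far concern the unit ball; homogeneity of T_m extends them to all f.
  have hscale : ∀ f : ellZ d p, ∃ g : ellZ d p, f = (‖f‖ : ℂ) • g ∧ ‖g‖ ≤ 1 := by
    intro f
    rcases eq_or_ne f 0 with rfl | hf
    · exact ⟨0, by simp, by simp⟩
    · refine ⟨(‖f‖ : ℂ)⁻¹ • f, ?_, ?_⟩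
      · rw [smul_inv_smul₀ (by simpa using hf)]
      · rw [norm_smul, norm_inv, Complex.norm_real, norm_norm,
          inv_mul_cancel₀ (by simpa using hf)]
  have hball : ∀ f : ellZ d p, ‖f‖ ≤ 1 → ∑' n, ‖toEll2 hp2 f n‖ₑ ^ p.toReal ≤ 1 := by
    intro f hf
    simp only [toEll2_apply]
    rw [tsum_enorm_rpow_eq hP0 f]
    simpa using Real.rpow_le_one (norm_nonneg f) hf hP0.le
  have hint1 : ∀ f : ellZ d p, ‖f‖ ≤ 1 →
      Integrable (symbolMul m (toEll2 hp2 f)) (torusMeasure d) := fun f hf =>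
    integrable_symbolMul_of_lintegral_le hqr.symm.pos hm.1 hC _ fun g => hCfg _ g (hball f hf)
  have hint : ∀ f : ellZ d p, Integrable (symbolMul m (toEll2 hp2 f)) (torusMeasure d) := by
    intro f
    obtain ⟨g, hfg, hg⟩ := hscale f
    rw [hfg, toEll2_smul]
    exact ((hint1 g hg).smul _).congr (symbolMul_smul_ae m _ _).symm
  have hsum1 : ∀ f : ellZ d p, ‖f‖ ≤ 1 → ∀ s : Finset (Fin d → ℤ),
      ∑ n ∈ s, ‖multiplierT m (toEll2 hp2 f) n‖ ^ q.toReal ≤ C.toReal ^ q.toReal := fun f hf =>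
    sum_norm_multiplierT_rpow_le hqr hC (hint f) fun g => hCfg _ g (hball f hf)
  have hsum : ∀ (f : ellZ d p) (s : Finset (Fin d → ℤ)),
      ∑ n ∈ s, ‖multiplierT m (toEll2 hp2 f) n‖ ^ q.toReal ≤
        (C.toReal * ‖f‖) ^ q.toReal := by
    intro f s
    obtain ⟨g, hfg, hg⟩ := hscale f
    have h : ∀ n, ‖multiplierT m (toEll2 hp2 f) n‖ ^ q.toReal =
        ‖f‖ ^ q.toReal * ‖multiplierT m (toEll2 hp2 g) n‖ ^ q.toReal := by
      intro n
      conv_lhs => rw [hfg, toEll2_smul, multiplierT_smul]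
      rw [Pi.smul_apply, norm_smul, Complex.norm_real, norm_norm,
        Real.mul_rpow (norm_nonneg _) (norm_nonneg _)]
    simp only [h]
    rw [← Finset.mul_sum, Real.mul_rpow ENNReal.toReal_nonneg (norm_nonneg _), mul_comm]
    gcongr
    exact hsum1 g hg s
  exact ⟨hint, exists_continuousLinearMap_of_sum_norm_rpow_le hQ0 ENNReal.toReal_nonneg
    (fun f => multiplierT m (toEll2 hp2 f))
    (fun f g => by rw [toEll2_add, multiplierT_add (hint f) (hint g)])
    (fun c f => by rw [toEll2_smul, multiplierT_smul]) hsum⟩
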